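/- Let $N\ge 1$ be an integer and let $f(z)=\sum_{n>0}a_f(n)e^{2\pi i n z}$ be a holomorphic cusp form of weight $2$ for $\Gamma_0(N)$ such that $f|_2W_N=f$, where $W_N=\begin{pmatrix}0&-1/\sqrt N\\ \sqrt N&0\end{pmatrix}$, that is, $(\sqrt N z)^{-2}f(-1/(Nz))=f(z)$ for all $z$ in the upper half-plane. Let $L_f(s)$ be the $L$-function of $f$, i.e. the entire continuation of $\sum_{n\ge1}a_f(n)n^{-s}$, and let $$L_f^*(s)=\left(\frac{\sqrt N}{2\pi}\right)^{s}\Gamma(s)L_f(s)$$ be the completed $L$-function. Then $$(L_f^*)'(1)=2\sqrt N\, i\int_{i/\sqrt N}^{i/\sqrt N+1}f(z)\left(\log\Gamma(z)+\left(\log\sqrt N-\frac{\pi i}{2}\right)z\right)dz,$$ where the integral is along the horizontal segment from $i/\sqrt N$ to $i/\sqrt N+1$, on which the integrand is integrable, and $\log$ is the principal branch of the logarithm (on this segment $\log\Gamma(z)$ is continuous and agrees with the analytic log-gamma function). -/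

import Mathlib

open scoped MatrixGroups ModularForm

noncomputable section

/-- The congruence subgroup `Γ₀(N)`, viewed inside `GL₂(ℝ)`. -/
abbrev Gamma0R (N : ℕ) : Subgroup (GL (Fin 2) ℝ) :=
  (CongruenceSubgroup.Gamma0 N).map (Matrix.SpecialLinearGroup.mapGL ℝ)

/-- The Fricke matrix `W_N = (0, -1/√N; √N, 0)`, of determinant `1`. -/
def frickeMatrix (N : ℕ) [NeZero N] : GL (Fin 2) ℝ :=
  Matrix.GeneralLinearGroup.mkOfDetNeZero !![0, -1 / √(N : ℝ); √(N : ℝ), 0] (by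
    have h : √(N : ℝ) ≠ 0 :=
      Real.sqrt_ne_zero'.mpr (Nat.cast_pos.mpr (Nat.pos_of_ne_zero (NeZero.ne N)))
    rw [Matrix.det_fin_two_of]
    field_simp
    norm_num)

/-- The `L`-function `L_f(s)` of a weight `2` cusp form `f` of level `N`: the entire continuation
of the Dirichlet series `∑ a_f(n) n⁻ˢ`, see `hasSum_cuspL`. -/
def cuspL {N : ℕ} [NeZero N] (f : CuspForm (Gamma0R N) 2) (s : ℂ) : ℂ :=
  ModularForm.L (two_pos : (0 : ℤ) < 2) f s

/-- The completed `L`-function `L_f^*(s) = (√N / 2π)ˢ Γ(s) L_f(s)`. -/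
def completedCuspL {N : ℕ} [NeZero N] (f : CuspForm (Gamma0R N) 2) (s : ℂ) : ℂ :=
  ((√(N : ℝ) / (2 * Real.pi) : ℝ) : ℂ) ^ s * Complex.Gamma s * cuspL f s

/-- The integrand `f(z) (log Γ(z) + (log √N - πi/2) z)`, as a function on `ℂ` which is meaningful
for `z` in the upper half-plane. -/
def logGammaIntegrand {N : ℕ} (f : CuspForm (Gamma0R N) 2) (z : ℂ) : ℂ :=
  f (UpperHalfPlane.ofComplex z) *
    (Complex.log (Complex.Gamma z) +
      ((Real.log √(N : ℝ) : ℂ) - Real.pi * Complex.I / 2) * z)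

theorem differentiable_cuspL {N : ℕ} [NeZero N] (f : CuspForm (Gamma0R N) 2) :
    Differentiable ℂ (cuspL f) :=
  CuspForm.differentiable_L _ f

theorem hasSum_cuspL {N : ℕ} [NeZero N] (f : CuspForm (Gamma0R N) 2) {s : ℂ} (hs : 2 < s.re) :
    HasSum (fun n : ℕ ↦ (UpperHalfPlane.qExpansion 1 f).coeff n / (n : ℂ) ^ s) (cuspL f s) := by
  have h := CuspForm.hasSum_L (k := 2) two_pos f (s := s) (by norm_num; linarith)
  simpa [cuspL, Gamma0R] using h

end

/-! On `Re s > 0`, `L_f^*(s)` is `(√N)^s` times the Mellin transform of `f(it)`, so its derivative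
at `1` is `√N ∫₀^∞ log(√N t) f(it) dt`. Fricke invariance makes `(0, 1/√N)` and `(1/√N, ∞)`
contribute equally (`integral_Ioi_zero_eq_two_mul`). Put `G(z) = log Γ(z) + (log √N - πi/2) z`. The
functional equation of `Γ` gives `G(z+1) - G(z) = log(√N t)` at `z = it`, so by periodicity of `f`
the integral over `(1/√N, ∞)` is the difference of `f G` over two vertical sides of a half-strip.
Cauchy's theorem moves it to the bottom edge, since exponential decay of `f` kills the top edge.
This needs a holomorphic `log Γ`, built from Euler's product; on the bottom edge its imaginary part
is small enough for it to be the principal logarithm of `Γ` (`log_Gamma_eq_analyticLogGamma`). -/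

namespace LogGamma

open Complex Filter Topology Set

/-! ### Estimates for log(1 + w) on the right half-plane -/

theorem one_add_mem_slitPlane {w : ℂ} (hw : 0 ≤ w.re) : 1 + w ∈ slitPlane := by
  left
  simp
  linarith

theorem mem_slitPlane_of_re_nonneg {z : ℂ} (hz : 0 ≤ z.re) (hz0 : z ≠ 0) : z ∈ slitPlane := by
  rw [mem_slitPlane_iff]
  by_contra! h
  exact hz0 (Complex.ext (le_antisymm h.1 hz) h.2)

/-- Integrate `(1 + tw)⁻¹ - 1` over `[0, 1]`: as `Re w ≥ 0`, the denominator has norm at least `1`,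
so `w` need not be small. -/
theorem norm_log_one_add_sub_self_le {w : ℂ} (hw : 0 ≤ w.re) :
    ‖log (1 + w) - w‖ ≤ ‖w‖ ^ 2 / 2 := by
  have hs := one_add_mem_slitPlane hw
  have hc := continuousOn_one_add_mul_inv hs
  rw [← uIcc_of_le zero_le_one] at hc
  have h1 : log (1 + w) - w = w * ∫ t in (0 : ℝ)..1, ((1 + t • w)⁻¹ - 1) := by
    rw [intervalIntegral.integral_sub hc.intervalIntegrable (by simp), ← sub_eq_zero,
      log_eq_integral hs]
    simp
    ring
  have h2 : ‖∫ t in (0 : ℝ)..1, ((1 + t • w)⁻¹ - 1)‖ ≤ ∫ t in (0 : ℝ)..1, t * ‖w‖ := by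
    refine intervalIntegral.norm_integral_le_of_norm_le zero_le_one ?_
      (Continuous.intervalIntegrable (by fun_prop) _ _)
    filter_upwards with t ht
    have hre : 1 ≤ ‖1 + t • w‖ := by
      refine le_trans ?_ (re_le_norm _)
      have := mul_nonneg ht.1.le hw
      simp
      exact this
    have hne : 1 + t • w ≠ 0 := norm_pos_iff.mp (by linarith)
    have : (1 + t • w)⁻¹ - 1 = -(t • w) / (1 + t • w) := by
      field_simp
      ring
    rw [this, norm_div, norm_neg, norm_smul, Real.norm_of_nonneg ht.1.le]
    exact div_le_self (by have := ht.1; positivity) hre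
  rw [h1, norm_mul]
  refine (mul_le_mul_of_nonneg_left h2 (norm_nonneg _)).trans_eq ?_
  simp
  ring

theorem abs_log_one_add_sub_self_le {x : ℝ} (hx : 0 ≤ x) : |Real.log (1 + x) - x| ≤ x ^ 2 / 2 := by
  have h := norm_log_one_add_sub_self_le (w := (x : ℂ)) (by simpa)
  rw [← ofReal_one, ← ofReal_add, ← ofReal_log (by linarith), ← ofReal_sub, norm_real, norm_real,
    Real.norm_eq_abs, Real.norm_eq_abs, sq_abs] at h
  exact h

/-- With `θ = arg (1 + w)` in `[0, π/2)`, `θ ≤ tan θ = Im w / (1 + Re w)`. -/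
theorem log_im_le_im {w : ℂ} (hw : 0 ≤ w.re) (hi : 0 ≤ w.im) : (log (1 + w)).im ≤ w.im := by
  have h0 : 0 ≤ arg (1 + w) := arg_nonneg_iff.mpr (by simpa)
  have h1 : arg (1 + w) < Real.pi / 2 := by
    refine (le_abs_self _).trans_lt (abs_arg_lt_pi_div_two_iff.mpr (Or.inl ?_))
    simp
    linarith
  rw [log_im]
  refine (Real.le_tan h0 h1).trans ?_
  rw [tan_arg]
  simp
  exact div_le_self hi (by linarith)

/-! ### The series for log Γ and its regularity -/

/-- The `n`-th term of the series for the logarithm of Euler's product for `Γ`. -/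
noncomputable def term (n : ℕ) (z : ℂ) : ℂ :=
  z * (Real.log (1 + 1 / ((n : ℝ) + 1)) : ℂ) - log (1 + z / ((n : ℂ) + 1))

theorem div_succ_re (z : ℂ) (n : ℕ) : (z / ((n : ℂ) + 1)).re = z.re / ((n : ℝ) + 1) := by
  rw [← ofReal_natCast, ← ofReal_one, ← ofReal_add, div_ofReal_re]

theorem div_succ_im (z : ℂ) (n : ℕ) : (z / ((n : ℂ) + 1)).im = z.im / ((n : ℝ) + 1) := by
  rw [← ofReal_natCast, ← ofReal_one, ← ofReal_add, div_ofReal_im]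

theorem norm_div_succ (z : ℂ) (n : ℕ) : ‖z / ((n : ℂ) + 1)‖ = ‖z‖ / ((n : ℝ) + 1) := by
  rw [← ofReal_natCast, ← ofReal_one, ← ofReal_add, norm_div, norm_real, Real.norm_of_nonneg]
  positivity

theorem div_succ_re_nonneg {z : ℂ} (hz : 0 ≤ z.re) (n : ℕ) : 0 ≤ (z / ((n : ℂ) + 1)).re := by
  rw [div_succ_re]
  positivity

/-- The first-order parts `z/(n+1)` of the two logarithms cancel, leaving quadratic errors. -/
theorem norm_term_le {z : ℂ} (hz : 0 ≤ z.re) (n : ℕ) :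
    ‖term n z‖ ≤ (‖z‖ + ‖z‖ ^ 2) / 2 * (1 / ((n : ℝ) + 1) ^ 2) := by
  have h1 := norm_log_one_add_sub_self_le (div_succ_re_nonneg hz n)
  have h2 := abs_log_one_add_sub_self_le (x := 1 / ((n : ℝ) + 1)) (by positivity)
  rw [norm_div_succ] at h1
  have : term n z = z * ((Real.log (1 + 1 / ((n : ℝ) + 1)) - 1 / ((n : ℝ) + 1) : ℝ) : ℂ) -
      (log (1 + z / ((n : ℂ) + 1)) - z / ((n : ℂ) + 1)) := by
    rw [term]
    push_cast
    ring
  rw [this]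
  refine (norm_sub_le _ _).trans ?_
  rw [norm_mul, norm_real, Real.norm_eq_abs]
  refine (add_le_add (mul_le_mul_of_nonneg_left h2 (norm_nonneg _)) h1).trans_eq ?_
  field_simp

theorem hasSum_one_div_succ_sq : HasSum (fun n : ℕ ↦ 1 / ((n : ℝ) + 1) ^ 2) (Real.pi ^ 2 / 6) := by
  have h := (hasSum_nat_add_iff' 1).mpr hasSum_zeta_two
  simpa using h

theorem summable_term {z : ℂ} (hz : 0 ≤ z.re) : Summable fun n ↦ term n z :=
  .of_norm_bounded (hasSum_one_div_succ_sq.summable.mul_left _) (norm_term_le hz)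

/-- The holomorphic logarithm of `Γ` on the right half-plane. -/
noncomputable def analyticLogGamma (z : ℂ) : ℂ := -log z + ∑' n, term n z

theorem norm_tsum_term_le {z : ℂ} (hz : 0 ≤ z.re) :
    ‖∑' n, term n z‖ ≤ ‖z‖ + ‖z‖ ^ 2 := by
  refine (tsum_of_norm_bounded (hasSum_one_div_succ_sq.mul_left _) (norm_term_le hz)).trans ?_
  have : Real.pi ^ 2 ≤ 12 := by nlinarith [Real.pi_lt_d2, Real.pi_pos]
  nlinarith [norm_nonneg z, sq_nonneg ‖z‖]

theorem norm_analyticLogGamma_le {z : ℂ} (hz : 0 ≤ z.re) (hz1 : 1 ≤ ‖z‖) :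
    ‖analyticLogGamma z‖ ≤ 2 * ‖z‖ + ‖z‖ ^ 2 + Real.pi := by
  have h1 : ‖log z‖ ≤ ‖z‖ + Real.pi := by
    refine (norm_le_abs_re_add_abs_im _).trans ?_
    rw [log_re, log_im, abs_of_nonneg (Real.log_nonneg hz1)]
    have := Real.log_le_sub_one_of_pos (show 0 < ‖z‖ by linarith)
    linarith [abs_arg_le_pi z]
  have := norm_tsum_term_le hz
  have h3 := norm_add_le (-log z) (∑' n, term n z)
  rw [norm_neg] at h3
  rw [analyticLogGamma]
  linarith

theorem continuousOn_term (n : ℕ) : ContinuousOn (term n) {z | 0 ≤ z.re} := by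
  unfold term
  refine ContinuousOn.sub (by fun_prop) (ContinuousOn.clog (by fun_prop) fun z hz ↦ ?_)
  exact one_add_mem_slitPlane (div_succ_re_nonneg hz n)

theorem differentiableOn_term (n : ℕ) : DifferentiableOn ℂ (term n) {z | 0 < z.re} := by
  unfold term
  refine DifferentiableOn.sub (by fun_prop) (DifferentiableOn.clog (by fun_prop) fun z hz ↦ ?_)
  exact one_add_mem_slitPlane (div_succ_re_nonneg (le_of_lt hz) n)

theorem norm_term_le_of_mem_ball {z : ℂ} {R : ℝ} (hz : 0 ≤ z.re) (hR : ‖z‖ < R) (n : ℕ) :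
    ‖term n z‖ ≤ (R + R ^ 2) / 2 * (1 / ((n : ℝ) + 1) ^ 2) := by
  refine (norm_term_le hz n).trans ?_
  gcongr

/-- The boundary line `Re z = 0` is included because the left side of the contour lies on it. -/
theorem continuousOn_analyticLogGamma :
    ContinuousOn analyticLogGamma {z | 0 ≤ z.re ∧ z ≠ 0} := by
  unfold analyticLogGamma
  refine ContinuousOn.add (ContinuousOn.neg (ContinuousOn.clog continuousOn_id
    fun z hz ↦ mem_slitPlane_of_re_nonneg hz.1 hz.2)) ?_
  intro z hz
  -- The M-test needs a bound uniform in `z`, hence the restriction to a ball.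
  have h := continuousOn_tsum (f := term) (s := {z | 0 ≤ z.re} ∩ Metric.ball 0 (‖z‖ + 1))
    (fun n ↦ (continuousOn_term n).mono inter_subset_left)
    (hasSum_one_div_succ_sq.summable.mul_left ((‖z‖ + 1 + (‖z‖ + 1) ^ 2) / 2))
    (fun n w hw ↦ norm_term_le_of_mem_ball hw.1 (by simpa using hw.2) n)
  have h' := h z ⟨hz.1, by simp⟩
  rw [continuousWithinAt_inter (Metric.isOpen_ball.mem_nhds (by simp))] at h'
  exact h'.mono fun w hw ↦ hw.1

theorem differentiableOn_analyticLogGamma :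
    DifferentiableOn ℂ analyticLogGamma {z | 0 < z.re} := by
  unfold analyticLogGamma
  refine DifferentiableOn.add (DifferentiableOn.neg (DifferentiableOn.clog differentiableOn_id
    fun z hz ↦ Or.inl hz)) ?_
  intro z hz
  have ho : IsOpen ({z : ℂ | 0 < z.re} ∩ Metric.ball 0 (‖z‖ + 1)) :=
    (isOpen_lt continuous_const continuous_re).inter Metric.isOpen_ball
  have h := differentiableOn_tsum_of_summable_norm (F := term)
    (hasSum_one_div_succ_sq.summable.mul_left ((‖z‖ + 1 + (‖z‖ + 1) ^ 2) / 2))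
    (fun n ↦ (differentiableOn_term n).mono inter_subset_left) ho
    (fun n w hw ↦ norm_term_le_of_mem_ball (le_of_lt hw.1) (by simpa using hw.2) n)
  exact (h.differentiableAt (ho.mem_nhds ⟨hz, by simp⟩)).differentiableWithinAt

/-! ### Functional equation and exponential of the series -/

theorem log_one_add_div_succ {z : ℂ} (hz : 0 ≤ z.re) (n : ℕ) :
    log (1 + z / ((n : ℂ) + 1)) = log (z + (n + 1)) - (Real.log ((n : ℝ) + 1) : ℂ) := by
  have hn : (0 : ℝ) < (n : ℝ) + 1 := by positivity
  have hne : 1 + z / ((n : ℂ) + 1) ≠ 0 :=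
    slitPlane_ne_zero (one_add_mem_slitPlane (div_succ_re_nonneg hz n))
  have h := log_ofReal_mul hn hne
  rw [eq_sub_iff_add_eq, add_comm, ← h]
  congr 1
  have : (n : ℂ) + 1 ≠ 0 := by exact_mod_cast hn.ne'
  push_cast
  field_simp
  ring

theorem sum_log_one_add_one_div_succ (n : ℕ) :
    ∑ j ∈ Finset.range n, Real.log (1 + 1 / ((j : ℝ) + 1)) = Real.log ((n : ℝ) + 1) := by
  induction n with
  | zero => simp
  | succ n ih =>
    rw [Finset.sum_range_succ, ih, ← Real.log_mul (by positivity) (by positivity)]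
    congr 1
    push_cast
    field_simp

theorem sum_term {z : ℂ} (hz : 0 ≤ z.re) (n : ℕ) :
    ∑ j ∈ Finset.range n, term j z = z * (Real.log ((n : ℝ) + 1) : ℂ) -
      ∑ j ∈ Finset.range n, (log (z + (j + 1)) - (Real.log ((j : ℝ) + 1) : ℂ)) := by
  simp only [term, Finset.sum_sub_distrib, log_one_add_div_succ hz, ← Finset.mul_sum]
  rw [← sum_log_one_add_one_div_succ]
  push_cast
  rfl

theorem tendsto_sum_term {z : ℂ} (hz : 0 ≤ z.re) :
    Tendsto (fun n ↦ -log z + ∑ j ∈ Finset.range n, term j z) atTop (𝓝 (analyticLogGamma z)) :=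
  (summable_term hz).hasSum.tendsto_sum_nat.const_add _

theorem tendsto_div_succ_zero (z : ℂ) : Tendsto (fun n : ℕ ↦ z / ((n : ℂ) + 1)) atTop (𝓝 0) := by
  have h := (tendsto_one_div_add_atTop_nhds_zero_nat (𝕜 := ℂ)).const_mul z
  simpa [div_eq_mul_inv] using h

/-- The difference of partial sums telescopes to `log z - log (1 + z/(n+1))`. -/
theorem analyticLogGamma_add_one {z : ℂ} (hz : 0 ≤ z.re) :
    analyticLogGamma (z + 1) - analyticLogGamma z = log z := by
  have hz1 : 0 ≤ (z + 1).re := by simp; linarith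
  have h := (tendsto_sum_term hz1).sub (tendsto_sum_term hz)
  have hlog : Tendsto (fun n : ℕ ↦ log z - log (1 + z / ((n : ℂ) + 1))) atTop (𝓝 (log z)) := by
    have := ((tendsto_div_succ_zero z).const_add 1).clog (by simp)
    simpa using this.const_sub (log z)
  refine tendsto_nhds_unique h (hlog.congr fun n ↦ ?_)
  rw [sum_term hz, sum_term hz1, log_one_add_div_succ hz]
  have htel : ∑ j ∈ Finset.range n, (log (z + 1 + (j + 1)) - log (z + (j + 1))) =
      log (z + (n + 1)) - log (z + 1) := by
    have := Finset.sum_range_sub (fun j : ℕ ↦ log (z + 1 + j)) n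
    simp only [Nat.cast_zero, add_zero] at this
    rw [add_comm (n : ℂ), ← add_assoc, ← this]
    refine Finset.sum_congr rfl fun j _ ↦ ?_
    push_cast
    congr 2
    ring
  simp only [Finset.sum_sub_distrib] at htel ⊢
  linear_combination htel

theorem tendsto_log_sub_log_succ :
    Tendsto (fun n : ℕ ↦ Real.log n - Real.log ((n : ℝ) + 1)) atTop (𝓝 0) := by
  have h : Tendsto (fun n : ℕ ↦ Real.log ((n : ℝ) / ((n : ℝ) + 1))) atTop (𝓝 0) := by
    simpa using (tendsto_natCast_div_add_atTop (𝕜 := ℝ) 1).log one_ne_zero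
  refine h.congr' ?_
  filter_upwards [eventually_ne_atTop 0] with n hn
  rw [Real.log_div (by exact_mod_cast hn) (by positivity)]

theorem exp_analyticLogGamma {z : ℂ} (hz : 0 ≤ z.re) (hz0 : z ≠ 0) :
    exp (analyticLogGamma z) = Gamma z := by
  -- The partial sums carry `z log (n+1)` where `GammaSeq` has `n ^ z`; the added term, which tends
  -- to `0`, corrects this.
  have h1 := (tendsto_sum_term hz).add
    (((continuous_ofReal.tendsto _).comp tendsto_log_sub_log_succ).const_mul z)
  have h2 := (continuous_exp.tendsto _).comp h1
  simp only [ofReal_zero, mul_zero, add_zero] at h2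
  refine tendsto_nhds_unique h2 ((GammaSeq_tendsto_Gamma z).congr' ?_)
  filter_upwards [eventually_ne_atTop 0] with n hn
  have hn' : (n : ℂ) ≠ 0 := by exact_mod_cast hn
  have hj (j : ℕ) : z + ((j : ℂ) + 1) ≠ 0 := by
    refine slitPlane_ne_zero (Or.inl ?_)
    simp
    positivity
  have hprod : exp (∑ j ∈ Finset.range n, (log (z + (j + 1)) - (Real.log ((j : ℝ) + 1) : ℂ))) =
      (∏ j ∈ Finset.range n, (z + ((j : ℂ) + 1))) / (n.factorial : ℂ) := by
    rw [exp_sum, ← Finset.prod_range_add_one_eq_factorial]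
    push_cast
    rw [← Finset.prod_div_distrib]
    refine Finset.prod_congr rfl fun j _ ↦ ?_
    rw [exp_sub, exp_log (hj j), ← ofReal_exp, Real.exp_log (by positivity)]
    push_cast
    rfl
  have hne : ∏ j ∈ Finset.range n, (z + ((j : ℂ) + 1)) ≠ 0 :=
    Finset.prod_ne_zero_iff.mpr fun j _ ↦ hj j
  have harg : -log z + ∑ j ∈ Finset.range n, term j z +
      z * ((Real.log n - Real.log ((n : ℝ) + 1) : ℝ) : ℂ) = log n * z - log z -
      ∑ j ∈ Finset.range n, (log (z + (j + 1)) - (Real.log ((j : ℝ) + 1) : ℂ)) := by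
    rw [sum_term hz, natCast_log.symm]
    push_cast
    ring
  simp only [Function.comp_apply]
  rw [harg, exp_sub, exp_sub, hprod, exp_log hz0, ← cpow_def_of_ne_zero hn', GammaSeq,
    Finset.prod_range_succ']
  push_cast
  rw [add_zero]
  field_simp

/-! ### Comparison with the principal logarithm on the unit square -/

theorem term_im_bounds {z : ℂ} (hz : 0 ≤ z.re) (hz1 : z.re ≤ 1) (hi : 0 ≤ z.im) (hi1 : z.im ≤ 1)
    (n : ℕ) : -(1 / 2 * (1 / ((n : ℝ) + 1) ^ 2)) ≤ (term n z).im ∧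
      (term n z).im ≤ 1 * (1 / ((n : ℝ) + 1) ^ 2) := by
  set t : ℝ := 1 / ((n : ℝ) + 1) with ht
  have ht0 : 0 ≤ t := by positivity
  have him : (term n z).im = z.im * Real.log (1 + t) - (log (1 + z / ((n : ℂ) + 1))).im := by
    rw [term, sub_im, im_mul_ofReal]
  have hw : (z / ((n : ℂ) + 1)).im = z.im * t := by rw [div_succ_im, ht, mul_one_div]
  have h1 := abs_le.mp (abs_log_one_add_sub_self_le ht0)
  have h2 : Real.log (1 + t) ≤ t := by
    have := Real.log_le_sub_one_of_pos (show 0 < 1 + t by linarith)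
    linarith
  have h3 := log_im_le_im (div_succ_re_nonneg hz n) (by rw [hw]; positivity)
  have h4 := norm_log_one_add_sub_self_le (div_succ_re_nonneg hz n)
  have h5 := (abs_le.mp ((abs_im_le_norm _).trans h4)).1
  have h6 : ‖z‖ ^ 2 ≤ 2 := by
    rw [Complex.sq_norm, normSq_apply]
    nlinarith
  have h7 : ‖z / ((n : ℂ) + 1)‖ ^ 2 / 2 ≤ t ^ 2 := by
    rw [norm_div_succ, div_eq_mul_one_div ‖z‖, ← ht]
    nlinarith [sq_nonneg t]
  rw [sub_im, hw] at h5
  rw [hw] at h3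
  have h8 : 1 / ((n : ℝ) + 1) ^ 2 = t ^ 2 := by rw [ht, one_div_pow]
  rw [him, h8]
  constructor
  · nlinarith [sq_nonneg t]
  · nlinarith

/-- The series has imaginary part in `[-π²/12, π²/6]` and `-arg z` lies in `[-π/2, 0]`, so the total
lies in `(-π, π]`. -/
theorem log_Gamma_eq_analyticLogGamma {z : ℂ} (hz : 0 ≤ z.re) (hz1 : z.re ≤ 1) (hi : 0 < z.im)
    (hi1 : z.im ≤ 1) : log (Gamma z) = analyticLogGamma z := by
  have hz0 : z ≠ 0 := fun h ↦ by simp [h] at hi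
  have hs := hasSum_im (summable_term hz).hasSum
  have hlo := hasSum_le (fun n ↦ (term_im_bounds hz hz1 hi.le hi1 n).1)
    (hasSum_one_div_succ_sq.mul_left (1 / 2)).neg hs
  have hhi := hasSum_le (fun n ↦ (term_im_bounds hz hz1 hi.le hi1 n).2) hs
    (hasSum_one_div_succ_sq.mul_left 1)
  have ha0 : 0 ≤ arg z := arg_nonneg_iff.mpr hi.le
  have ha1 : arg z ≤ Real.pi / 2 := arg_le_pi_div_two_iff.mpr (Or.inl hz)
  have hpi : Real.pi < 3.15 := Real.pi_lt_d2
  have hpi3 : 3 < Real.pi := Real.pi_gt_three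
  rw [← exp_analyticLogGamma hz hz0]
  apply log_exp
  · rw [analyticLogGamma, add_im, neg_im, log_im]
    nlinarith
  · rw [analyticLogGamma, add_im, neg_im, log_im]
    nlinarith

end LogGamma

namespace CuspForm

open Complex Filter Topology Set MeasureTheory
open UpperHalfPlane hiding I
open scoped Interval

variable {N : ℕ}

/-! ### Symmetries of f and the Mellin integral -/

theorem apply_ofComplex_add_one (f : CuspForm (Gamma0R N) 2) (z : ℂ) :
    f (ofComplex (z + 1)) = f (ofComplex z) := by
  have h1 : (1 : ℝ) ∈ (Gamma0R N).strictPeriods := by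
    have := (Gamma0R N).strictWidthInfty_mem_strictPeriods
    rwa [Gamma0R, CongruenceSubgroup.strictWidthInfty_Gamma0] at this
  simpa using SlashInvariantFormClass.periodic_comp_ofComplex f h1 z

theorem differentiableOn_comp_ofComplex [NeZero N] (f : CuspForm (Gamma0R N) 2) :
    DifferentiableOn ℂ (fun z ↦ f (ofComplex z)) {z | 0 < z.im} :=
  UpperHalfPlane.mdifferentiable_iff.mp (CuspFormClass.holo f)

/-- `W_N` sends `it` to `i/(Nt)`, with automorphy factor `(√N · it)² = -N t²`. -/
theorem apply_fricke [NeZero N] (f : CuspForm (Gamma0R N) 2)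
    (hf : (f : ℍ → ℂ) ∣[(2 : ℤ)] frickeMatrix N = f) {t : ℝ} (ht : 0 < t) :
    f (ofComplex (I * ((1 / (N * t) : ℝ) : ℂ))) = -(N * t ^ 2) * f (ofComplex (I * t)) := by
  have hN : (0 : ℝ) < N := Nat.cast_pos.mpr (Nat.pos_of_ne_zero (NeZero.ne N))
  have hs : (√(N : ℝ) : ℂ) ^ 2 = N := by
    rw [← ofReal_pow, Real.sq_sqrt hN.le, ofReal_natCast]
  have hs0 : (√(N : ℝ) : ℂ) ≠ 0 := by
    exact_mod_cast (Real.sqrt_pos.mpr hN).ne'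
  have ht0 : (t : ℂ) ≠ 0 := by exact_mod_cast ht.ne'
  have hN0 : (N : ℂ) ≠ 0 := by exact_mod_cast hN.ne'
  have hco : ((ofComplex (I * t) : ℍ) : ℂ) = I * t := by
    rw [ofComplex_apply_of_im_pos (by simpa)]
  have hval : ((frickeMatrix N : GL (Fin 2) ℝ) : Matrix (Fin 2) (Fin 2) ℝ) =
      !![0, -1 / √(N : ℝ); √(N : ℝ), 0] := rfl
  have hdet : (frickeMatrix N).det.val = 1 := by
    rw [Matrix.GeneralLinearGroup.val_det_apply, hval, Matrix.det_fin_two_of]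
    have := (Real.sqrt_pos.mpr hN).ne'
    field_simp
    norm_num
  have hact : frickeMatrix N • ofComplex (I * t) = ofComplex (I * ((1 / (N * t) : ℝ) : ℂ)) := by
    ext
    rw [coe_smul_of_det_pos (by rw [hdet]; exact one_pos),
      ofComplex_apply_of_im_pos (z := I * ((1 / (N * t) : ℝ) : ℂ)) (by simp; positivity)]
    simp only [num, denom, hval, hco]
    simp
    field_simp
    rw [hs]
    simp
  have h := congr_fun hf (ofComplex (I * t))
  rw [ModularForm.slash_def] at h
  beta_reduce at h
  rw [hact] at h
  have hden : denom (frickeMatrix N) (ofComplex (I * t)) = √(N : ℝ) * (I * t) := by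
    simp [denom, hval, hco]
  rw [hden] at h
  have hdet' : (frickeMatrix N).det = 1 := Units.ext hdet
  simp only [σ, hdet'] at h
  generalize f (ofComplex (I * ((1 / (N * t) : ℝ) : ℂ))) = v at h ⊢
  simp [zpow_neg] at h
  rw [← h]
  field_simp
  rw [hs, I_sq]
  ring

theorem mellinConvergent_and_hasDerivAt_mellin [NeZero N] (f : CuspForm (Gamma0R N) 2) :
    MellinConvergent (fun t : ℝ ↦ f (ofComplex (I * t))) 1 ∧
    MellinConvergent (fun t : ℝ ↦ Real.log t • f (ofComplex (I * t))) 1 ∧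
    HasDerivAt (mellin fun t : ℝ ↦ f (ofComplex (I * t)))
      (mellin (fun t : ℝ ↦ Real.log t • f (ofComplex (I * t))) 1) 1 := by
  have hP := CuspForm.isStrongFEPair (two_pos : (0 : ℤ) < 2) f
  -- Decay is rapid at both ends, so any exponents `b < 1 < a` serve; here `a = 2`, `b = 0`.
  have h := mellin_hasDerivAt_of_isBigO_rpow (s := 1)
    (ModularForm.weakFEPair (two_pos : (0 : ℤ) < 2) f).hf_int
    (hP.hf_top (-2)) (by norm_num) (b := 0) (hP.hf_zero _) (by norm_num)
  exact ⟨(hP.hasMellin 1).1, h⟩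

theorem completedCuspL_eq_mellin [NeZero N] (f : CuspForm (Gamma0R N) 2) {s : ℂ} (hs : 0 < s.re) :
    completedCuspL f s = (√(N : ℝ) : ℂ) ^ s * mellin (fun t : ℝ ↦ f (ofComplex (I * t))) s := by
  have h2π : (((2 * Real.pi : ℝ) : ℂ)) ^ s ≠ 0 := by
    rw [Ne, cpow_eq_zero_iff]
    rintro ⟨h, -⟩
    exact Real.two_pi_pos.ne' (by exact_mod_cast h)
  have hΓ := Gamma_ne_zero_of_re_pos hs
  rw [completedCuspL, cuspL, ModularForm.L, CuspForm.Λ_eq_mellin, Gammaℂ, ofReal_div,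
    div_cpow_ofReal_nonneg (Real.sqrt_nonneg _) Real.two_pi_pos.le, cpow_neg]
  rw [ofReal_mul] at h2π ⊢
  rw [ofReal_ofNat] at h2π ⊢
  field_simp

/-- Differentiating `(√N)^s` gives `log √N` and differentiating `t^(s-1)` gives `log t`; they
combine. -/
theorem hasDerivAt_completedCuspL [NeZero N] (f : CuspForm (Gamma0R N) 2) :
    IntegrableOn (fun t : ℝ ↦ (Real.log (√(N : ℝ) * t) : ℂ) * f (ofComplex (I * t))) (Ioi 0) ∧
    HasDerivAt (completedCuspL f) (√(N : ℝ) *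
      ∫ t in Ioi (0 : ℝ), (Real.log (√(N : ℝ) * t) : ℂ) * f (ofComplex (I * t))) 1 := by
  have hN : (0 : ℝ) < √(N : ℝ) :=
    Real.sqrt_pos.mpr (Nat.cast_pos.mpr (Nat.pos_of_ne_zero (NeZero.ne N)))
  have hN0 : (√(N : ℝ) : ℂ) ≠ 0 := by exact_mod_cast hN.ne'
  obtain ⟨h1, h2, h3⟩ := mellinConvergent_and_hasDerivAt_mellin f
  simp only [MellinConvergent, sub_self, cpow_zero, one_smul] at h1 h2
  have heq : EqOn (fun t : ℝ ↦ (Real.log (√(N : ℝ) * t) : ℂ) * f (ofComplex (I * t)))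
      (fun t : ℝ ↦ (Real.log √(N : ℝ) : ℂ) * f (ofComplex (I * t)) +
        Real.log t • f (ofComplex (I * t))) (Ioi 0) := by
    intro t ht
    simp only [real_smul]
    rw [Real.log_mul hN.ne' (ne_of_gt ht)]
    push_cast
    ring
  refine ⟨(integrableOn_congr_fun heq measurableSet_Ioi).mpr ((h1.const_mul _).add h2), ?_⟩
  rw [setIntegral_congr_fun measurableSet_Ioi heq, integral_add (h1.const_mul _) h2,
    integral_const_mul]
  have hd := (((hasDerivAt_id (1 : ℂ)).const_cpow (Or.inl hN0)).mul h3).congr_of_eventuallyEq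
    (f₁ := completedCuspL f) (by
      filter_upwards [(isOpen_lt continuous_const Complex.continuous_re).mem_nhds
        (show (0 : ℝ) < (1 : ℂ).re by simp)] with s hs
      exact completedCuspL_eq_mellin f hs)
  refine hd.congr_deriv ?_
  simp only [mellin, sub_self, cpow_zero, one_smul, id, cpow_one, ofReal_log hN.le]
  ring

/-- Under `t ↦ 1/(Nt)` the logarithm changes sign, as does `f` up to a factor `N t²`, which the
Jacobian removes. -/
theorem integral_Ioi_zero_eq_two_mul [NeZero N] (f : CuspForm (Gamma0R N) 2)
    (hf : (f : ℍ → ℂ) ∣[(2 : ℤ)] frickeMatrix N = f) :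
    ∫ t in Ioi (0 : ℝ), (Real.log (√(N : ℝ) * t) : ℂ) * f (ofComplex (I * t)) =
      2 * ∫ t in Ioi (1 / √(N : ℝ)),
        (Real.log (√(N : ℝ) * t) : ℂ) * f (ofComplex (I * t)) := by
  have hNN : (0 : ℝ) < N := Nat.cast_pos.mpr (Nat.pos_of_ne_zero (NeZero.ne N))
  have hN : (0 : ℝ) < √(N : ℝ) := Real.sqrt_pos.mpr hNN
  have ha : (0 : ℝ) < 1 / √(N : ℝ) := by positivity
  have hss : √(N : ℝ) * √(N : ℝ) = N := Real.mul_self_sqrt hNN.le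
  have hint := (hasDerivAt_completedCuspL f).1
  have himg : (fun t : ℝ ↦ 1 / (N * t)) '' Ioi (1 / √(N : ℝ)) = Ioo 0 (1 / √(N : ℝ)) := by
    ext x
    simp only [mem_image, mem_Ioi, mem_Ioo]
    -- `1/√N` is the fixed point of the inversion.
    have key : 1 / ((N : ℝ) * (1 / √(N : ℝ))) = 1 / √(N : ℝ) := by
      field_simp
      rw [sq, hss]
    constructor
    · rintro ⟨t, ht, rfl⟩
      have ht0 := ha.trans ht
      refine ⟨by positivity, ?_⟩
      rw [← key]
      gcongr
    · rintro ⟨hx0, hx⟩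
      refine ⟨1 / (N * x), ?_, by field_simp⟩
      nth_rewrite 1 [← key]
      gcongr
  have hderiv : ∀ t ∈ Ioi (1 / √(N : ℝ)),
      HasDerivWithinAt (fun t : ℝ ↦ 1 / (N * t)) (-(1 / (N * t ^ 2))) (Ioi (1 / √(N : ℝ))) t := by
    intro t ht
    have ht0 : t ≠ 0 := (ha.trans ht).ne'
    have := ((hasDerivAt_id t).const_mul (N : ℝ)).inv (by simp [ht0, hNN.ne'])
    refine HasDerivAt.hasDerivWithinAt ?_
    simp only [one_div]
    refine this.congr_deriv ?_
    simp only [id]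
    field_simp
  have hinj : InjOn (fun t : ℝ ↦ 1 / (N * t)) (Ioi (1 / √(N : ℝ))) := by
    intro x hx y hy hxy
    have hx0 : x ≠ 0 := (ha.trans hx).ne'
    have hy0 : y ≠ 0 := (ha.trans hy).ne'
    simp only [one_div, inv_inj] at hxy
    exact mul_left_cancel₀ hNN.ne' hxy
  have hcov := integral_image_eq_integral_abs_deriv_smul measurableSet_Ioi hderiv hinj
    (fun t : ℝ ↦ (Real.log (√(N : ℝ) * t) : ℂ) * f (ofComplex (I * t)))
  rw [himg] at hcov
  have hcongr : ∀ t ∈ Ioi (1 / √(N : ℝ)), |(-(1 / ((N : ℝ) * t ^ 2)))| •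
      ((Real.log (√(N : ℝ) * (1 / (N * t))) : ℂ) *
        f (ofComplex (I * ((1 / (N * t) : ℝ) : ℂ)))) =
      (Real.log (√(N : ℝ) * t) : ℂ) * f (ofComplex (I * t)) := by
    intro t ht
    have ht0 : 0 < t := ha.trans ht
    have hlog : √(N : ℝ) * (1 / (N * t)) = (√(N : ℝ) * t)⁻¹ := by
      nth_rewrite 2 [← hss]
      field_simp
    rw [apply_fricke f hf ht0, hlog, Real.log_inv, abs_neg, abs_of_pos (by positivity), real_smul]
    push_cast
    have h1 : (N : ℂ) ≠ 0 := by exact_mod_cast hNN.ne'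
    have h2 : (t : ℂ) ≠ 0 := by exact_mod_cast ht0.ne'
    field_simp
  rw [setIntegral_congr_fun measurableSet_Ioi hcongr] at hcov
  rw [← Ioc_union_Ioi_eq_Ioi ha.le, setIntegral_union Ioc_disjoint_Ioi_same measurableSet_Ioi
    (hint.mono_set Ioc_subset_Ioi_self) (hint.mono_set (Ioi_subset_Ioi ha.le)),
    integral_Ioc_eq_integral_Ioo, hcov, two_mul]

/-! ### The contour integral -/

/-- The integrand of the contour integral, with the holomorphic logarithm of `Γ`. -/
noncomputable def analyticIntegrand (f : CuspForm (Gamma0R N) 2) (z : ℂ) : ℂ :=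
  f (ofComplex z) * (LogGamma.analyticLogGamma z +
    ((Real.log √(N : ℝ) : ℂ) - Real.pi * I / 2) * z)

/-- The coefficient `log √N - πi/2` is chosen for this: it cancels the `πi/2` in `log (it) = log t +
πi/2` and supplies `log √N`. -/
theorem analyticIntegrand_sub [NeZero N] (f : CuspForm (Gamma0R N) 2) {t : ℝ} (ht : 0 < t) :
    analyticIntegrand f (1 + t * I) - analyticIntegrand f (t * I) =
      (Real.log (√(N : ℝ) * t) : ℂ) * f (ofComplex (I * t)) := by
  have hN : (0 : ℝ) < √(N : ℝ) :=
    Real.sqrt_pos.mpr (Nat.cast_pos.mpr (Nat.pos_of_ne_zero (NeZero.ne N)))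
  have h := LogGamma.analyticLogGamma_add_one (z := t * I) (by simp)
  rw [log_ofReal_mul ht I_ne_zero, log_I] at h
  rw [analyticIntegrand, analyticIntegrand, add_comm 1, apply_ofComplex_add_one,
    Real.log_mul hN.ne' ht.ne', mul_comm I]
  push_cast
  linear_combination f (ofComplex (t * I)) * h

theorem continuousOn_analyticIntegrand [NeZero N] (f : CuspForm (Gamma0R N) 2) :
    ContinuousOn (analyticIntegrand f) {z | 0 ≤ z.re ∧ 0 < z.im} := by
  refine ((differentiableOn_comp_ofComplex f).continuousOn.mono fun z hz ↦ hz.2).mul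
    ((LogGamma.continuousOn_analyticLogGamma.mono fun z hz ↦ ⟨hz.1, ?_⟩).add (by fun_prop))
  rintro rfl
  simp at hz

theorem differentiableOn_analyticIntegrand [NeZero N] (f : CuspForm (Gamma0R N) 2) :
    DifferentiableOn ℂ (analyticIntegrand f) {z | 0 < z.re ∧ 0 < z.im} :=
  ((differentiableOn_comp_ofComplex f).mono fun z hz ↦ hz.2).mul
    ((LogGamma.differentiableOn_analyticLogGamma.mono fun z hz ↦ hz.1).add (by fun_prop))

theorem integral_rect_analyticIntegrand [NeZero N] (f : CuspForm (Gamma0R N) 2) {a T : ℝ}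
    (ha : 0 < a) (haT : a ≤ T) :
    ((∫ x in (0 : ℝ)..1, analyticIntegrand f (x + a * I)) -
      ∫ x in (0 : ℝ)..1, analyticIntegrand f (x + T * I)) +
      I * ∫ t in a..T, (Real.log (√(N : ℝ) * t) : ℂ) * f (ofComplex (I * t)) = 0 := by
  have hsub : ([[(0 : ℝ), 1]] ×ℂ [[a, T]]) ⊆ {z : ℂ | 0 ≤ z.re ∧ 0 < z.im} := by
    rw [uIcc_of_le zero_le_one, uIcc_of_le haT]
    intro z hz
    exact ⟨hz.1.1, ha.trans_le hz.2.1⟩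
  have h := integral_boundary_rect_eq_zero_of_continuousOn_of_differentiableOn
    (analyticIntegrand f) (a * I) (1 + T * I)
    ((continuousOn_analyticIntegrand f).mono (by simpa using hsub))
    ((differentiableOn_analyticIntegrand f).mono (by
      intro z hz
      simp [haT] at hz
      exact ⟨hz.1.1, ha.trans hz.2.1⟩))
  simp at h
  have hvert (b : ℝ) (hb : 0 ≤ b) :
      IntervalIntegrable (fun t : ℝ ↦ analyticIntegrand f (b + t * I)) volume a T := by
    refine ContinuousOn.intervalIntegrable
      ((continuousOn_analyticIntegrand f).comp (by fun_prop) fun t ht ↦ ?_)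
    rw [uIcc_of_le haT] at ht
    simpa [hb] using ha.trans_le ht.1
  have h0 := hvert 0 le_rfl
  have h1 := hvert 1 zero_le_one
  simp at h0 h1
  have hJ : ∫ t in a..T, (Real.log (√(N : ℝ) * t) : ℂ) * f (ofComplex (I * t)) =
      (∫ t in a..T, analyticIntegrand f (1 + t * I)) -
        ∫ t in a..T, analyticIntegrand f (t * I) := by
    rw [← intervalIntegral.integral_sub h1 h0]
    refine intervalIntegral.integral_congr fun t ht ↦ ?_
    rw [uIcc_of_le haT] at ht
    exact (analyticIntegrand_sub f (ha.trans_le ht.1)).symm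
  rw [hJ]
  linear_combination h

/-- Exponential decay of `f` beats the quadratic growth of the other factor. -/
theorem tendsto_integral_analyticIntegrand [NeZero N] (f : CuspForm (Gamma0R N) 2) :
    Tendsto (fun T : ℝ ↦ ∫ x in (0 : ℝ)..1, analyticIntegrand f (x + T * I)) atTop (𝓝 0) := by
  obtain ⟨c, hc, hO⟩ := CuspFormClass.exp_decay_atImInfty' f
  obtain ⟨K, hK⟩ := hO.bound
  obtain ⟨A, hA⟩ := (UpperHalfPlane.atImInfty_mem _).mp hK
  set C : ℝ := ‖(Real.log √(N : ℝ) : ℂ) - Real.pi * I / 2‖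
  -- From `‖z‖ ≤ 2T` and `T ≥ 1`: `2‖z‖ + ‖z‖² + π + C‖z‖ ≤ (8 + 2C + π) T²`.
  have hlim : Tendsto (fun T : ℝ ↦ |K| * Real.exp (-c * T) * ((8 + 2 * C + Real.pi) * T ^ 2))
      atTop (𝓝 0) := by
    have h := (tendsto_rpow_mul_exp_neg_mul_atTop_nhds_zero 2 c hc).const_mul
      (|K| * (8 + 2 * C + Real.pi))
    rw [mul_zero] at h
    refine h.congr fun T ↦ ?_
    rw [Real.rpow_two]
    ring
  refine squeeze_zero_norm' ?_ hlim
  filter_upwards [eventually_ge_atTop A, eventually_ge_atTop 1] with T hTA hT1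
  refine (intervalIntegral.norm_integral_le_of_norm_le_const (C := _) fun x hx ↦ ?_).trans_eq
    (by rw [sub_zero, abs_one, mul_one])
  rw [uIoc_of_le zero_le_one] at hx
  set z : ℂ := x + T * I with hz
  have hre : z.re = x := by simp [hz]
  have him : z.im = T := by simp [hz]
  have hz1 : 1 ≤ ‖z‖ := by
    refine le_trans ?_ (abs_im_le_norm z)
    rw [him]
    exact hT1.trans (le_abs_self _)
  have hz2 : ‖z‖ ≤ 2 * T := by
    refine (norm_le_abs_re_add_abs_im z).trans ?_
    rw [hre, him, abs_of_pos hx.1, abs_of_nonneg (by linarith)]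
    linarith [hx.2]
  have hfz : ‖f (ofComplex z)‖ ≤ |K| * Real.exp (-c * T) := by
    have hco : (ofComplex z).im = T := by
      rw [ofComplex_apply_of_im_pos (by rw [him]; linarith)]
      exact him
    have := hA (ofComplex z) (by rw [hco]; exact hTA)
    simp only [mem_ofPred_eq, hco, Real.norm_eq_abs, Real.abs_exp] at this
    exact this.trans (by gcongr; exact le_abs_self K)
  have hG := LogGamma.norm_analyticLogGamma_le (z := z) (by rw [hre]; exact hx.1.le) hz1
  rw [analyticIntegrand, norm_mul]
  refine mul_le_mul hfz ?_ (norm_nonneg _) (by positivity)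
  refine (norm_add_le _ _).trans ?_
  rw [norm_mul]
  have hC : 0 ≤ C := norm_nonneg _
  have hpi := Real.pi_pos
  have h1 : ‖z‖ ^ 2 ≤ (2 * T) ^ 2 := by gcongr
  have h2 : C * ‖z‖ ≤ C * (2 * T) := by gcongr
  have h3 : T ≤ T ^ 2 := by nlinarith
  nlinarith [mul_le_mul_of_nonneg_left h3 hC, mul_le_mul_of_nonneg_left (hT1.trans h3) hpi.le]

theorem integral_analyticIntegrand [NeZero N] (f : CuspForm (Gamma0R N) 2) {a : ℝ} (ha : 0 < a) :
    ∫ t in Ioi a, (Real.log (√(N : ℝ) * t) : ℂ) * f (ofComplex (I * t)) =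
      I * ∫ x in (0 : ℝ)..1, analyticIntegrand f (x + a * I) := by
  have h1 := intervalIntegral_tendsto_integral_Ioi a
    ((hasDerivAt_completedCuspL f).1.mono_set (Ioi_subset_Ioi ha.le)) tendsto_id
  have h2 := ((tendsto_integral_analyticIntegrand f).const_sub
    (∫ x in (0 : ℝ)..1, analyticIntegrand f (x + a * I))).const_mul I
  rw [sub_zero] at h2
  refine tendsto_nhds_unique h1 (h2.congr' ?_)
  filter_upwards [eventually_ge_atTop a] with T hT
  have h := integral_rect_analyticIntegrand f ha hT
  simp only [id]
  linear_combination I * h -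
    (∫ t in a..T, (Real.log (√(N : ℝ) * t) : ℂ) * f (ofComplex (I * t))) * I_sq

/-- Since `N ≥ 1`, the height `1/√N` is at most `1`, so the segment lies in the unit square. -/
theorem logGammaIntegrand_eq [NeZero N] (f : CuspForm (Gamma0R N) 2) {x : ℝ} (hx : 0 ≤ x)
    (hx1 : x ≤ 1) : logGammaIntegrand f (I / (√(N : ℝ) : ℂ) + x) =
      analyticIntegrand f (x + (1 / √(N : ℝ) : ℝ) * I) := by
  have hN : (1 : ℝ) ≤ √(N : ℝ) :=
    Real.one_le_sqrt.mpr (Nat.one_le_cast.mpr (Nat.pos_of_ne_zero (NeZero.ne N)))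
  have hz : I / (√(N : ℝ) : ℂ) + x = x + (1 / √(N : ℝ) : ℝ) * I := by
    push_cast
    ring
  have hre : ((x : ℂ) + (1 / √(N : ℝ) : ℝ) * I).re = x := by simp
  have him : ((x : ℂ) + (1 / √(N : ℝ) : ℝ) * I).im = 1 / √(N : ℝ) := by
    rw [add_im, ofReal_im, im_ofReal_mul, Complex.I_im, mul_one, zero_add]
  rw [hz, logGammaIntegrand, analyticIntegrand, LogGamma.log_Gamma_eq_analyticLogGamma]
  · rwa [hre]
  · rwa [hre]
  · rw [him]
    positivity
  · rw [him]
    exact div_le_one_of_le₀ hN (by positivity)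

theorem intervalIntegrable_analyticIntegrand [NeZero N] (f : CuspForm (Gamma0R N) 2) {a : ℝ}
    (ha : 0 < a) :
    IntervalIntegrable (fun x : ℝ ↦ analyticIntegrand f (x + a * I)) volume 0 1 := by
  refine ContinuousOn.intervalIntegrable
    ((continuousOn_analyticIntegrand f).comp (by fun_prop) fun t ht ↦ ?_)
  rw [uIcc_of_le zero_le_one] at ht
  simpa [ha] using ht.1

end CuspForm

theorem theorem1p2 (N : ℕ) [NeZero N] (f : CuspForm (Gamma0R N) 2)
    (hf : (f : UpperHalfPlane → ℂ) ∣[(2 : ℤ)] frickeMatrix N = f) :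
    IntervalIntegrable
        (fun x : ℝ ↦ logGammaIntegrand f (Complex.I / (√(N : ℝ) : ℂ) + x))
        MeasureTheory.volume 0 1 ∧
      HasDerivAt (completedCuspL f)
        (2 * (√(N : ℝ) : ℂ) * Complex.I *
          ∫ x in (0 : ℝ)..1, logGammaIntegrand f (Complex.I / (√(N : ℝ) : ℂ) + x)) 1 := by
  have hN : (0 : ℝ) < 1 / √(N : ℝ) := one_div_pos.mpr
    (Real.sqrt_pos.mpr (Nat.cast_pos.mpr (Nat.pos_of_ne_zero (NeZero.ne N))))
  have heq : Set.EqOn (fun x : ℝ ↦ logGammaIntegrand f (Complex.I / (√(N : ℝ) : ℂ) + x))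
      (fun x : ℝ ↦ CuspForm.analyticIntegrand f (x + (1 / √(N : ℝ) : ℝ) * Complex.I))
      (Set.uIcc 0 1) := by
    intro x hx
    rw [Set.uIcc_of_le zero_le_one] at hx
    exact CuspForm.logGammaIntegrand_eq f hx.1 hx.2
  constructor
  · exact (CuspForm.intervalIntegrable_analyticIntegrand f hN).congr
      (heq.symm.mono Set.uIoc_subset_uIcc)
  · refine (CuspForm.hasDerivAt_completedCuspL f).2.congr_deriv ?_
    rw [intervalIntegral.integral_congr heq, CuspForm.integral_Ioi_zero_eq_two_mul f hf,
      CuspForm.integral_analyticIntegrand f hN]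
    ring
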